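/- Consider $n$ qubits with the Majorana operators $\gamma_{2j-1}=\big(\prod_{k<j}Z_k\big)X_j$, $\gamma_{2j}=\big(\prod_{k<j}Z_k\big)Y_j$ ($1\le j\le n$). For a state $\rho$ let $(\Gamma_\rho)_{ab}=-\tfrac{i}{2}\operatorname{tr}(\rho[\gamma_a,\gamma_b])$ be its real $2n\times 2n$ covariance matrix and $\operatorname{FAF}_1(\rho)=n-\tfrac12\operatorname{tr}(-\Gamma_\rho^2)$. Write $\operatorname{FAF}_1(\psi)=\operatorname{FAF}_1(|\psi\rangle\langle\psi|)$ for a unit vector $\psi$. Let $\mathcal G_n$ be the set of pure fermionic Gaussian states, i.e. of unit vectors $\phi$ with $\Gamma_{|\phi\rangle\langle\phi|}^2=-I_{2n}$, and let $\epsilon_G(\psi)=\inf_{\phi\in\mathcal G_n}\tfrac12\big\||\psi\rangle\langle\psi|-|\phi\rangle\langle\phi|\big\|_1$. (1) Let $n\ge4$ be even. For every real $\epsilon$ with $0\le\epsilon\le 1/\sqrt2$, the unit vector $\psi_{n,\epsilon}=\sqrt{1-\epsilon^2}\,|0\rangle^{\otimes n}+\epsilon\,|1\rangle^{\otimes n}$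 satisfies $\epsilon_G(\psi_{n,\epsilon})=\epsilon$, the infimum being attained, and $\operatorname{FAF}_1(\psi_{n,\epsilon})=4n\epsilon^2(1-\epsilon^2)$. (2) Consequently the factor $1/(4n)$ in the inequality $\tfrac1{4n}\operatorname{FAF}_1(\psi)\le\epsilon_G(\psi)^2$ is essentially tight: for every even $n\ge4$, $\operatorname{FAF}_1(\psi_{n,\epsilon})/(n\,\epsilon_G(\psi_{n,\epsilon})^2)\to4$ as $\epsilon\downarrow0$; for every even $n\ge4$, if $c\in\mathbb R$ is such that $\tfrac cn\operatorname{FAF}_1(\psi)\le\epsilon_G(\psi)^2$ for all pure states $\psi$ of $n$ qubits, then $c\le\tfrac14$; and there is no $c>0$ such that $c\operatorname{FAF}_1(\psi)\le\epsilon_G(\psi)^2$ for all $n\ge1$ and all pure states $\psi$ of $n$ qubits. (3) For every $n\ge4$, the unit vector $\psi_n=\tfrac1{\sqrt2}(|0000\rangle+|1111\rangle)\otimes|0\rangle^{\otimes(n-4)}$ satisfies $\operatorname{FAF}_1(\psi_n)=4$ and $\epsilon_G(\psi_n)^2=\tfrac12$, the infimum in $\epsilon_G(\psi_n)$ being attained.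 Consequently there is no constant $C\in\mathbb R$ such that $\epsilon_G(\psi)^2\le C\operatorname{FAF}_1(\psi)/n$ for all $n\ge1$ and all pure states $\psi$ of $n$ qubits. -/

import Mathlib

open scoped Topology Matrix

noncomputable section

namespace FAF

/-- The state space of `n` qubits (equivalently, `n` fermionic modes): square-summable amplitudes on
the occupation strings `x : Fin n → Fin 2`. -/
abbrev State (n : ℕ) : Type := EuclideanSpace ℂ (Fin n → Fin 2)

/-- Operators on `n` qubits, as matrices in the occupation basis. -/
abbrev Op (n : ℕ) : Type := Matrix (Fin n → Fin 2) (Fin n → Fin 2) ℂ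

/-- The occupation basis vector `|x₁ … xₙ⟩`. -/
def ket {n : ℕ} (x : Fin n → Fin 2) : State n := EuclideanSpace.single x 1

/-- The product `|u⟩ ⊗ |v⟩` of an `m`-qubit state and a `k`-qubit state. -/
def tensorState {m k : ℕ} (u : State m) (v : State k) : State (m + k) :=
  WithLp.toLp 2 fun x => u (fun i => x (Fin.castAdd k i)) * v (fun j => x (Fin.natAdd m j))

/-- The density operator `|ψ⟩⟨ψ|`. -/
def density {n : ℕ} (ψ : State n) : Op n := Matrix.of fun x y => ψ x * star (ψ y)

/-- The Pauli matrices. -/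
def pauliX : Matrix (Fin 2) (Fin 2) ℂ := !![0, 1; 1, 0]

def pauliY : Matrix (Fin 2) (Fin 2) ℂ := !![0, -Complex.I; Complex.I, 0]

def pauliZ : Matrix (Fin 2) (Fin 2) ℂ := !![1, 0; 0, -1]

/-- The operator `A₁ ⊗ ⋯ ⊗ Aₙ` on `n` qubits. -/
def tensorOp {n : ℕ} (A : Fin n → Matrix (Fin 2) (Fin 2) ℂ) : Op n :=
  Matrix.of fun x y => ∏ j, A j (x j) (y j)

/-- The `2n` Majorana operators in the Jordan–Wigner representation. The index `(j, 0)` stands for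
`γ_{2j-1} = (∏_{k<j} Z_k) X_j` and `(j, 1)` for `γ_{2j} = (∏_{k<j} Z_k) Y_j`. -/
def majorana {n : ℕ} (a : Fin n × Fin 2) : Op n :=
  tensorOp fun k =>
    if k < a.1 then pauliZ else if k = a.1 then (if a.2 = 0 then pauliX else pauliY) else 1

/-- The complex number `-(i/2) tr(ρ [γ_a, γ_b])`; it is real for Hermitian `ρ`
(see `covarianceEntry_im`). -/
def covarianceEntry {n : ℕ} (ρ : Op n) (a b : Fin n × Fin 2) : ℂ :=
  -Complex.I * (1 / 2) *
    Matrix.trace (ρ * (majorana a * majorana b - majorana b * majorana a))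

/-- The real covariance matrix `(Γ_ρ)_{ab} = -(i/2) tr(ρ [γ_a, γ_b])`. -/
def covariance {n : ℕ} (ρ : Op n) : Matrix (Fin n × Fin 2) (Fin n × Fin 2) ℝ :=
  Matrix.of fun a b => (covarianceEntry ρ a b).re

/-- The `k`-th order fermionic antiflatness `FAF_k(ρ) = n - ½ tr[(-Γ_ρ²)^k]`. -/
def faf {n : ℕ} (k : ℕ) (ρ : Op n) : ℝ :=
  n - (1 / 2) * Matrix.trace ((-(covariance ρ ^ 2)) ^ k)

/-- The set `𝒢_n` of pure fermionic Gaussian states: unit vectors whose covariance matrix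
satisfies `Γ² = -I`. -/
def pureGaussian (n : ℕ) : Set (State n) :=
  {φ | ‖φ‖ = 1 ∧ covariance (density φ) ^ 2 = -1}

/-- The trace norm `‖A‖₁`, the sum of the singular values of `A`. -/
def traceNorm {n : ℕ} (A : Op n) : ℝ :=
  ∑ i, √((Matrix.isHermitian_conjTranspose_mul_self A).eigenvalues i)

/-- The trace distance `½ ‖ρ - σ‖₁`. -/
def traceDist {n : ℕ} (ρ σ : Op n) : ℝ := (1 / 2) * traceNorm (ρ - σ)

/-- The trace distances from `ψ` to the pure Gaussian states. -/
def gaussianDistances {n : ℕ} (ψ : State n) : Set ℝ :=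
  (fun φ => traceDist (density ψ) (density φ)) '' pureGaussian n

/-- The distance `ε_G(ψ)` of `ψ` to the closest pure Gaussian state. -/
def epsG {n : ℕ} (ψ : State n) : ℝ := sInf (gaussianDistances ψ)

/-- The cat state `√(1-ε²) |0…0⟩ + ε |1…1⟩`. -/
def catState (n : ℕ) (ε : ℝ) : State n :=
  ((√(1 - ε ^ 2) : ℝ) : ℂ) • ket (fun _ => 0) + (ε : ℂ) • ket (fun _ => 1)

/-- The localized defect `(|0000⟩ + |1111⟩)/√2 ⊗ |0⟩^{⊗m}` on `4 + m` modes. -/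
def defectState (m : ℕ) : State (4 + m) :=
  tensorState (((1 / √2 : ℝ) : ℂ) • (ket (fun _ : Fin 4 => 0) + ket (fun _ : Fin 4 => 1)))
    (ket (fun _ : Fin m => 0))

theorem majorana_conjTranspose {n : ℕ} (a : Fin n × Fin 2) : (majorana a)ᴴ = majorana a := by
  ext x y
  simp only [majorana, tensorOp, Matrix.conjTranspose_apply, Matrix.of_apply, star_prod]
  refine Finset.prod_congr rfl fun k _ => ?_
  generalize x k = s
  generalize y k = t
  split_ifs <;> fin_cases s <;> fin_cases t <;> simp [pauliX, pauliY, pauliZ]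

theorem covarianceEntry_im {n : ℕ} {ρ : Op n} (hρ : ρ.IsHermitian) (a b : Fin n × Fin 2) :
    (covarianceEntry ρ a b).im = 0 := by
  rw [← Complex.conj_eq_iff_im]
  have h : (starRingEnd ℂ) (Matrix.trace (ρ * (majorana a * majorana b - majorana b * majorana a)))
      = -Matrix.trace (ρ * (majorana a * majorana b - majorana b * majorana a)) := by
    rw [starRingEnd_apply, ← Matrix.trace_conjTranspose, Matrix.conjTranspose_mul,
      Matrix.conjTranspose_sub, Matrix.conjTranspose_mul, Matrix.conjTranspose_mul,
      majorana_conjTranspose, majorana_conjTranspose, hρ.eq, Matrix.trace_mul_comm,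
      ← Matrix.trace_neg, ← mul_neg, neg_sub]
  rw [covarianceEntry, map_mul, h]
  simp [Complex.conj_ofNat]

end FAF

end

/-!
Let `V` be the matrix with columns `γ_a ψ`. The anticommutation relations give `Vᴴ V = 1 + i Γ` with
`Γ` real antisymmetric, so that the squared Frobenius norm of `V Vᵀ` is `tr (1 + Γ²) = 2 FAF₁(ψ)`.
Hence `V Vᵀ = 0` for a Gaussian state `φ`: its amplitudes satisfy quadratic relations, one for each
pair of occupation strings. Take strings `r`, `s` at Hamming distance at least three and flip the
same bit, one at which they differ, in both. The relation for the resulting pair expresses `φ_r φ_s`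
through products of other amplitudes, none of which repeats, and AM-GM with normalization gives
`|φ_r| + |φ_s| ≤ 1`. When `|b| ≤ |a|`, it follows that no Gaussian state overlaps with
`a |r⟩ + b |s⟩` more than `|r⟩` does, and the distance to the Gaussian states is `|b|`.
For such a superposition `Γ` is block diagonal with blocks `⟨Z_j⟩ J`, where `J` is the `2 × 2`
symplectic matrix; a mode at which `r` and `s` differ contributes `1 - (|a|² - |b|²)² = 4 |a|² |b|²`
to `FAF₁`, and every other mode contributes `0`.
-/

namespace FAF

open scoped Kronecker

/-! ### Trace distance of pure states -/

theorem sub_pow_three_of_isIdempotentElem {R A : Type*} [Ring R] [Ring A] [Module R A]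
    {p q : A} {c : R} (hp : IsIdempotentElem p) (hq : IsIdempotentElem q)
    (hpqp : p * q * p = c • p) (hqpq : q * p * q = c • q) :
    (p - q) ^ 3 = (1 - c) • (p - q) := by
  have hsq : (p - q) ^ 2 = p + q - p * q - q * p := by
    rw [pow_two, mul_sub, sub_mul, sub_mul, hp.eq, hq.eq]
    abel
  have hp' : (p - q) ^ 2 * p = (1 - c) • p := by
    rw [hsq]
    simp only [sub_mul, add_mul, hpqp, hp.eq, mul_assoc q p p, sub_smul, one_smul]
    abel
  have hq' : (p - q) ^ 2 * q = (1 - c) • q := by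
    rw [hsq]
    simp only [sub_mul, add_mul, hqpq, hq.eq, mul_assoc p q q, sub_smul, one_smul]
    abel
  rw [pow_succ, mul_sub, hp', hq', smul_sub]

theorem eigenvalues_eq_zero_or_eq_of_sq_eq_smul {m 𝕜 : Type*} [Fintype m] [DecidableEq m]
    [RCLike 𝕜] {B : Matrix m m 𝕜} (hB : B.IsHermitian) {c : ℝ} (hsq : B ^ 2 = c • B) (i : m) :
    hB.eigenvalues i = 0 ∨ hB.eigenvalues i = c := by
  have : Nonempty m := ⟨i⟩
  let p : Polynomial ℝ := .X ^ 2 - .C c * .X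
  have hp : Polynomial.aeval B p = 0 := by simp [p, hsq, Algebra.smul_def]
  have hroot : p.eval (hB.eigenvalues i) = 0 := by
    have hmem := spectrum.subset_polynomial_aeval B p
      ⟨_, hB.eigenvalues_mem_spectrum_real i, rfl⟩
    rwa [hp, spectrum.zero_eq] at hmem
  have hfactor : hB.eigenvalues i * (hB.eigenvalues i - c) = 0 := by
    simp only [p, Polynomial.eval_sub, Polynomial.eval_pow, Polynomial.eval_mul,
      Polynomial.eval_X, Polynomial.eval_C] at hroot
    linear_combination hroot
  exact (mul_eq_zero.1 hfactor).imp_right sub_eq_zero.1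

variable {n : ℕ}

/- The hypothesis says that `A` is `t` times a partial isometry, so its singular values are `0` and
`t`; at `t = 0` both sides are `0`, by `x / 0 = 0`. -/
theorem traceNorm_eq_trace_div {A : Op n} {t : ℝ} (ht : 0 ≤ t)
    (hA : A * Aᴴ * A = t ^ 2 • A) : traceNorm A = (Aᴴ * A).trace.re / t := by
  have hH := Matrix.isHermitian_conjTranspose_mul_self A
  have hsq : (Aᴴ * A) ^ 2 = t ^ 2 • (Aᴴ * A) := by
    rw [pow_two, mul_assoc, ← mul_assoc A, hA, mul_smul_comm]
  have hsqrt (i) : √(hH.eigenvalues i) = hH.eigenvalues i / t := by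
    rcases eigenvalues_eq_zero_or_eq_of_sq_eq_smul hH hsq i with h | h
    · simp [h]
    · rw [h, Real.sqrt_sq ht, pow_two, mul_self_div_self]
  simp only [traceNorm, hsqrt, hH.trace_eq_sum_eigenvalues, ← Finset.sum_div]
  simp

theorem density_eq_vecMulVec (ψ : State n) :
    density ψ = Matrix.vecMulVec ψ.ofLp (star ψ.ofLp) := rfl

theorem isHermitian_density (ψ : State n) : (density ψ).IsHermitian := by
  rw [density_eq_vecMulVec, Matrix.IsHermitian, Matrix.conjTranspose_vecMulVec, star_star]

theorem density_mul_density (ψ φ : State n) :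
    density ψ * density φ = inner ℂ ψ φ • Matrix.vecMulVec ψ.ofLp (star φ.ofLp) := by
  rw [density_eq_vecMulVec, density_eq_vecMulVec, Matrix.vecMulVec_mul_vecMulVec,
    Matrix.vecMulVec_smul, EuclideanSpace.inner_eq_star_dotProduct, dotProduct_comm]

theorem isIdempotentElem_density {ψ : State n} (hψ : ‖ψ‖ = 1) : IsIdempotentElem (density ψ) := by
  rw [IsIdempotentElem, density_mul_density, inner_self_eq_norm_sq_to_K, hψ, density_eq_vecMulVec]
  simp

theorem inner_mul_inner_swap (ψ φ : State n) :
    inner ℂ ψ φ * inner ℂ φ ψ = ((‖inner ℂ ψ φ‖ ^ 2 : ℝ) : ℂ) := by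
  rw [← inner_conj_symm φ ψ, RCLike.mul_conj]
  norm_cast

theorem density_mul_density_mul_density (ψ φ : State n) :
    density ψ * density φ * density ψ = ‖inner ℂ ψ φ‖ ^ 2 • density ψ := by
  rw [density_mul_density, density_eq_vecMulVec ψ, Matrix.smul_mul,
    Matrix.vecMulVec_mul_vecMulVec, Matrix.vecMulVec_smul, smul_smul, dotProduct_comm,
    ← EuclideanSpace.inner_eq_star_dotProduct, inner_mul_inner_swap, Complex.coe_smul]

theorem trace_density (ψ : State n) : (density ψ).trace = ((‖ψ‖ ^ 2 : ℝ) : ℂ) := by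
  rw [density_eq_vecMulVec, Matrix.trace_vecMulVec, ← EuclideanSpace.inner_eq_star_dotProduct,
    inner_self_eq_norm_sq_to_K]
  norm_cast

theorem trace_density_mul_density (ψ φ : State n) :
    (density ψ * density φ).trace = ((‖inner ℂ ψ φ‖ ^ 2 : ℝ) : ℂ) := by
  rw [density_mul_density, Matrix.trace_smul, Matrix.trace_vecMulVec,
    ← EuclideanSpace.inner_eq_star_dotProduct, smul_eq_mul, inner_mul_inner_swap]

theorem trace_sq_density_sub_density {ψ φ : State n} (hψ : ‖ψ‖ = 1) (hφ : ‖φ‖ = 1) :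
    ((density ψ - density φ) ^ 2).trace = ((2 * (1 - ‖inner ℂ ψ φ‖ ^ 2) : ℝ) : ℂ) := by
  simp only [pow_two (density ψ - density φ), sub_mul, mul_sub, Matrix.trace_sub,
    Matrix.trace_mul_comm (density φ) (density ψ), trace_density_mul_density ψ φ,
    (isIdempotentElem_density hψ).eq, (isIdempotentElem_density hφ).eq, trace_density, hψ, hφ]
  push_cast
  ring

theorem traceDist_density {ψ φ : State n} (hψ : ‖ψ‖ = 1) (hφ : ‖φ‖ = 1) :
    traceDist (density ψ) (density φ) = √(1 - ‖inner ℂ ψ φ‖ ^ 2) := by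
  have hle : ‖inner ℂ ψ φ‖ ^ 2 ≤ 1 := by
    refine pow_le_one₀ (norm_nonneg _) ((norm_inner_le_norm (𝕜 := ℂ) ψ φ).trans_eq ?_)
    rw [hψ, hφ, mul_one]
  have hherm : (density ψ - density φ)ᴴ = density ψ - density φ :=
    ((isHermitian_density ψ).sub (isHermitian_density φ)).eq
  have hcube : (density ψ - density φ) ^ 3 =
      (1 - ‖inner ℂ ψ φ‖ ^ 2) • (density ψ - density φ) := by
    have hφψφ := density_mul_density_mul_density φ ψ
    rw [norm_inner_symm] at hφψφ
    exact sub_pow_three_of_isIdempotentElem (isIdempotentElem_density hψ)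
      (isIdempotentElem_density hφ) (density_mul_density_mul_density ψ φ) hφψφ
  have hnorm : traceNorm (density ψ - density φ) =
      2 * (1 - ‖inner ℂ ψ φ‖ ^ 2) / √(1 - ‖inner ℂ ψ φ‖ ^ 2) := by
    rw [pow_succ, pow_two, ← Real.sq_sqrt (sub_nonneg.2 hle)] at hcube
    rw [traceNorm_eq_trace_div (Real.sqrt_nonneg _) (by rwa [hherm]), hherm, ← pow_two,
      trace_sq_density_sub_density hψ hφ, Complex.ofReal_re]
  rw [traceDist, hnorm, mul_div_assoc, Real.div_sqrt]
  ring

/-! ### Majorana operators -/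

theorem tensorOp_mul (A B : Fin n → Matrix (Fin 2) (Fin 2) ℂ) :
    tensorOp A * tensorOp B = tensorOp fun k => A k * B k := by
  ext x y
  simp only [tensorOp, Matrix.mul_apply, Matrix.of_apply, ← Finset.prod_mul_distrib]
  rw [Finset.prod_univ_sum, Fintype.piFinset_univ]

theorem tensorOp_one : tensorOp (1 : Fin n → Matrix (Fin 2) (Fin 2) ℂ) = 1 := by
  ext x y
  simp [tensorOp, Matrix.one_apply, Finset.prod_ite_zero, funext_iff]

theorem tensorOp_mul_tensorOp_eq_neg {A B : Fin n → Matrix (Fin 2) (Fin 2) ℂ} (j : Fin n)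
    (hj : A j * B j = -(B j * A j)) (hne : ∀ k ≠ j, A k * B k = B k * A k) :
    tensorOp A * tensorOp B = -(tensorOp B * tensorOp A) := by
  rw [tensorOp_mul, tensorOp_mul]
  ext x y
  simp only [tensorOp, Matrix.of_apply, Matrix.neg_apply]
  rw [← Finset.mul_prod_erase _ _ (Finset.mem_univ j), hj,
    Finset.prod_congr rfl fun k hk => by rw [hne k (Finset.ne_of_mem_erase hk)],
    Matrix.neg_apply, neg_mul, Finset.mul_prod_erase _ (fun k => (B k * A k) (x k) (y k))
      (Finset.mem_univ j)]

theorem tensorOp_mulVec_of_monomial {A : Fin n → Matrix (Fin 2) (Fin 2) ℂ} {d : Fin n → Fin 2}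
    {f : Fin n → Fin 2 → ℂ} (hA : ∀ k s t, A k s t = if t = s + d k then f k s else 0)
    (v : (Fin n → Fin 2) → ℂ) (x : Fin n → Fin 2) :
    (tensorOp A *ᵥ v) x = (∏ k, f k (x k)) * v (x + d) := by
  have hentry (y) : tensorOp A x y = if y = x + d then ∏ k, f k (x k) else 0 := by
    simp [tensorOp, hA, Finset.prod_ite_zero, funext_iff]
  simp [Matrix.mulVec, dotProduct, hentry]

theorem pauliX_mul_self : pauliX * pauliX = 1 := by
  simp [pauliX, Matrix.one_fin_two]

theorem pauliY_mul_self : pauliY * pauliY = 1 := by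
  simp [pauliY, Matrix.one_fin_two]

theorem pauliZ_mul_self : pauliZ * pauliZ = 1 := by
  simp [pauliZ, Matrix.one_fin_two]

theorem pauliX_mul_pauliY : pauliX * pauliY = -(pauliY * pauliX) := by
  simp [pauliX, pauliY]

theorem pauliX_mul_pauliZ : pauliX * pauliZ = -(pauliZ * pauliX) := by
  simp [pauliX, pauliZ]

theorem pauliY_mul_pauliZ : pauliY * pauliZ = -(pauliZ * pauliY) := by
  simp [pauliY, pauliZ]

theorem majorana_mul_self (a : Fin n × Fin 2) : majorana a * majorana a = 1 := by
  rw [majorana, tensorOp_mul, ← tensorOp_one]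
  congr 1
  funext k
  split_ifs <;> simp [pauliX_mul_self, pauliY_mul_self, pauliZ_mul_self]

theorem majorana_mul_majorana_of_ne {a b : Fin n × Fin 2} (hab : a ≠ b) :
    majorana a * majorana b = -(majorana b * majorana a) := by
  wlog hle : a.1 ≤ b.1 generalizing a b
  · rw [this hab.symm (le_of_not_ge hle), neg_neg]
  obtain ⟨i, c⟩ := a
  obtain ⟨j, d⟩ := b
  refine tensorOp_mul_tensorOp_eq_neg i ?_ fun k hk => ?_
  · rcases eq_or_lt_of_le (show i ≤ j from hle) with rfl | hlt
    · fin_cases c <;> fin_cases d <;> simp_all [pauliX_mul_pauliY]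
    · simp only [lt_irrefl, if_false, if_true, hlt]
      split_ifs <;> simp [pauliX_mul_pauliZ, pauliY_mul_pauliZ]
  · have hlt : k < i → k < j := fun h => h.trans_le hle
    simp only [hk, if_false]
    split_ifs <;> first | simp | exact absurd (hlt ‹_›) ‹_›

theorem majorana_anticommutator (a b : Fin n × Fin 2) :
    majorana a * majorana b + majorana b * majorana a = if a = b then 2 else 0 := by
  split_ifs with hab
  · rw [hab, majorana_mul_self, one_add_one_eq_two]
  · rw [majorana_mul_majorana_of_ne hab, neg_add_cancel]

/-- The Jordan–Wigner sign `∏_{k<j} (-1)^{x_k}`, the eigenvalue of `∏_{k<j} Z_k` on `|x⟩`. -/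
def jwSign (j : Fin n) (x : Fin n → Fin 2) : ℂ := (-1) ^ ∑ k with k < j, (x k : ℕ)

theorem norm_jwSign (j : Fin n) (x : Fin n → Fin 2) : ‖jwSign j x‖ = 1 := by
  simp [jwSign]

theorem star_jwSign_mul_self (j : Fin n) (x : Fin n → Fin 2) :
    star (jwSign j x) * jwSign j x = 1 := by
  rw [Complex.star_def, Complex.conj_mul', norm_jwSign, Complex.ofReal_one, one_pow]

theorem majorana_mulVec (j : Fin n) (c : Fin 2) (v : (Fin n → Fin 2) → ℂ) (x : Fin n → Fin 2) :
    (majorana (j, c) *ᵥ v) x = jwSign j x *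
      (if c = 0 then 1 else -Complex.I * (-1) ^ (x j : ℕ)) * v (x + Pi.single j 1) := by
  rw [majorana, tensorOp_mulVec_of_monomial (d := Pi.single j 1)
    (f := fun k s => (if k < j then (-1) ^ (s : ℕ) else 1) *
      if k = j then (if c = 0 then 1 else -Complex.I * (-1) ^ (s : ℕ)) else 1)]
  · rw [Finset.prod_mul_distrib, Finset.prod_ite_eq', if_pos (Finset.mem_univ j),
      ← Finset.prod_filter, Finset.prod_pow_eq_pow_sum, jwSign]
  · intro k s t
    rcases lt_trichotomy k j with hlt | rfl | hgt
    · fin_cases s <;> fin_cases t <;> simp [hlt, hlt.ne, pauliZ]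
    · fin_cases c <;> fin_cases s <;> fin_cases t <;> simp [pauliX, pauliY]
    · fin_cases s <;> fin_cases t <;> simp [hgt.not_gt, hgt.ne']

theorem majorana_zero_mulVec (j : Fin n) (v : (Fin n → Fin 2) → ℂ) (x : Fin n → Fin 2) :
    (majorana (j, 0) *ᵥ v) x = jwSign j x * v (x + Pi.single j 1) := by
  simp [majorana_mulVec]

theorem majorana_one_mulVec (j : Fin n) (v : (Fin n → Fin 2) → ℂ) (x : Fin n → Fin 2) :
    (majorana (j, 1) *ᵥ v) x =
      -Complex.I * (-1) ^ (x j : ℕ) * (jwSign j x * v (x + Pi.single j 1)) := by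
  rw [majorana_mulVec, if_neg one_ne_zero]
  ring

/-! ### The Gram matrix of the Majorana images of a state -/

/-- The matrix with columns `γ_a ψ`. Its Gram matrix carries the covariance matrix of `ψ`. -/
def majoranaFrame (ψ : State n) : Matrix (Fin n → Fin 2) (Fin n × Fin 2) ℂ :=
  Matrix.of fun x a => (majorana a *ᵥ ψ.ofLp) x

theorem conjTranspose_majoranaFrame_mul_apply (ψ : State n) (a b : Fin n × Fin 2) :
    ((majoranaFrame ψ)ᴴ * majoranaFrame ψ) a b =
      (density ψ * (majorana a * majorana b)).trace := by
  have h : ((majoranaFrame ψ)ᴴ * majoranaFrame ψ) a b =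
      star (majorana a *ᵥ ψ.ofLp) ⬝ᵥ (majorana b *ᵥ ψ.ofLp) := rfl
  rw [h, Matrix.star_mulVec, majorana_conjTranspose, ← Matrix.dotProduct_mulVec,
    Matrix.mulVec_mulVec, Matrix.dotProduct_mulVec, density_eq_vecMulVec,
    Matrix.vecMulVec_mul, Matrix.trace_vecMulVec, dotProduct_comm]

theorem covariance_transpose (ρ : Op n) : (covariance ρ)ᵀ = -covariance ρ := by
  ext a b
  have h : covarianceEntry ρ b a = -covarianceEntry ρ a b := by
    rw [covarianceEntry, covarianceEntry, ← neg_sub (majorana a * majorana b), mul_neg,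
      Matrix.trace_neg, mul_neg]
  simp [covariance, h]

theorem covariance_density_apply (ψ : State n) (a b : Fin n × Fin 2) :
    covariance (density ψ) a b = (((majoranaFrame ψ)ᴴ * majoranaFrame ψ) a b).im := by
  have hswap := (Matrix.isHermitian_conjTranspose_mul_self (majoranaFrame ψ)).apply b a
  rw [covariance, Matrix.of_apply, covarianceEntry, mul_sub, Matrix.trace_sub,
    ← conjTranspose_majoranaFrame_mul_apply, ← conjTranspose_majoranaFrame_mul_apply, ← hswap,
    Complex.star_def, Complex.sub_conj]
  simp

theorem conjTranspose_majoranaFrame_mul {ψ : State n} (hψ : ‖ψ‖ = 1) :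
    (majoranaFrame ψ)ᴴ * majoranaFrame ψ =
      1 + Complex.I • (covariance (density ψ)).map Complex.ofReal := by
  ext a b
  have hre : ((((majoranaFrame ψ)ᴴ * majoranaFrame ψ) a b).re : ℂ) = (1 : Matrix _ _ ℂ) a b := by
    have hsum : ((majoranaFrame ψ)ᴴ * majoranaFrame ψ) a b +
        ((majoranaFrame ψ)ᴴ * majoranaFrame ψ) b a = 2 * (1 : Matrix _ _ ℂ) a b := by
      rw [conjTranspose_majoranaFrame_mul_apply, conjTranspose_majoranaFrame_mul_apply,
        ← Matrix.trace_add, ← mul_add, majorana_anticommutator, Matrix.one_apply]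
      split_ifs
      · rw [mul_two, Matrix.trace_add, trace_density, hψ]
        norm_num
      · simp
    rw [← (Matrix.isHermitian_conjTranspose_mul_self (majoranaFrame ψ)).apply b a,
      Complex.star_def, Complex.add_conj, Complex.ofReal_mul, Complex.ofReal_ofNat] at hsum
    exact mul_left_cancel₀ two_ne_zero hsum
  rw [Matrix.add_apply, ← hre, Matrix.smul_apply, Matrix.map_apply, covariance_density_apply,
    smul_eq_mul, mul_comm Complex.I, Complex.re_add_im]

theorem majoranaFrame_gram_mul_transpose {ψ : State n} (hψ : ‖ψ‖ = 1) :
    (majoranaFrame ψ)ᴴ * majoranaFrame ψ * ((majoranaFrame ψ)ᴴ * majoranaFrame ψ)ᵀ =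
      (1 + covariance (density ψ) ^ 2).map Complex.ofReal := by
  set Γ := (covariance (density ψ)).map Complex.ofReal with hΓ
  have hΓt : Γᵀ = -Γ := by
    rw [hΓ, ← Matrix.transpose_map, covariance_transpose]
    ext; simp
  have hsq : (1 + covariance (density ψ) ^ 2).map Complex.ofReal = 1 + Γ * Γ := by
    rw [pow_two]
    exact map_add Complex.ofRealHom.mapMatrix 1 _ |>.trans (by rw [map_one, map_mul]; rfl)
  rw [conjTranspose_majoranaFrame_mul hψ, hsq, Matrix.transpose_add, Matrix.transpose_one,
    Matrix.transpose_smul, hΓt]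
  simp only [mul_add, add_mul, mul_one, one_mul, smul_neg, Matrix.mul_neg, Matrix.smul_mul,
    Matrix.mul_smul, smul_smul, Complex.I_mul_I, neg_smul, one_smul]
  abel

theorem trace_majoranaFrame_mul_transpose {ψ : State n} (hψ : ‖ψ‖ = 1) :
    ((majoranaFrame ψ * (majoranaFrame ψ)ᵀ)ᴴ * (majoranaFrame ψ * (majoranaFrame ψ)ᵀ)).trace =
      ((2 * faf 1 (density ψ) : ℝ) : ℂ) := by
  set V := majoranaFrame ψ with hV
  calc ((V * Vᵀ)ᴴ * (V * Vᵀ)).trace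
    _ = (Vᵀᴴ * (Vᴴ * V * Vᵀ)).trace := by
      rw [Matrix.conjTranspose_mul]
      simp only [Matrix.mul_assoc]
    _ = (Vᴴ * V * (Vᴴ * V)ᵀ).trace := by
      rw [Matrix.trace_mul_comm, Matrix.transpose_mul, Matrix.mul_assoc (Vᴴ * V)]
      rfl
    _ = ((1 + covariance (density ψ) ^ 2).trace : ℂ) := by
      rw [hV, majoranaFrame_gram_mul_transpose hψ]
      exact (AddMonoidHom.map_trace Complex.ofRealHom _).symm
    _ = ((2 * faf 1 (density ψ) : ℝ) : ℂ) := by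
      congr 1
      rw [faf, pow_one, Matrix.trace_neg, Matrix.trace_add, Matrix.trace_one, Fintype.card_prod,
        Fintype.card_fin, Fintype.card_fin]
      push_cast
      ring

theorem faf_one_of_mem_pureGaussian {φ : State n} (hφ : φ ∈ pureGaussian n) :
    faf 1 (density φ) = 0 := by
  rw [faf, hφ.2, neg_neg, one_pow, Matrix.trace_one, Fintype.card_prod, Fintype.card_fin,
    Fintype.card_fin, Nat.cast_mul, Nat.cast_ofNat]
  ring

open scoped ComplexOrder in
theorem majoranaFrame_mul_transpose_of_mem_pureGaussian {φ : State n} (hφ : φ ∈ pureGaussian n) :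
    majoranaFrame φ * (majoranaFrame φ)ᵀ = 0 := by
  rw [← Matrix.trace_conjTranspose_mul_self_eq_zero_iff, trace_majoranaFrame_mul_transpose hφ.1,
    faf_one_of_mem_pureGaussian hφ, mul_zero, Complex.ofReal_zero]

/-! ### Amplitudes of a Gaussian state -/

theorem string_add_self (x : Fin n → Fin 2) : x + x = 0 :=
  funext fun i => (by decide : ∀ t : Fin 2, t + t = 0) (x i)

theorem hammingDist_add_right (x y z : Fin n → Fin 2) :
    hammingDist (x + z) (y + z) = hammingDist x y :=
  hammingDist_comp (fun i t => t + z i) fun _ => add_left_injective _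

theorem hammingDist_add_single (x : Fin n → Fin 2) (j : Fin n) :
    hammingDist x (x + Pi.single j 1) = 1 := by
  rw [hammingDist, Finset.card_eq_one]
  exact ⟨j, by ext k; simp [Pi.single_apply]⟩

theorem hammingDist_add_single_add_single (x : Fin n → Fin 2) {j k : Fin n} (hjk : j ≠ k) :
    hammingDist (x + Pi.single j 1) (x + Pi.single k 1) = 2 := by
  rw [hammingDist, Finset.card_eq_two]
  refine ⟨j, k, hjk, ?_⟩
  ext i
  by_cases hij : i = j <;> by_cases hik : i = k <;> simp_all [Pi.single_apply]

theorem add_norm_sq_le_of_sum_mul_eq_zero {ι : Type*} {f g : ι → ℂ} {s : Finset ι}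
    (h : ∑ j ∈ s, f j * g j = 0) {i : ι} (hi : i ∈ s) :
    (‖f i‖ + ‖g i‖) ^ 2 ≤ ∑ j ∈ s, (‖f j‖ ^ 2 + ‖g j‖ ^ 2) := by
  classical
  rw [← Finset.add_sum_erase _ _ hi] at h ⊢
  have hmul : ‖f i‖ * ‖g i‖ ≤ ∑ j ∈ s.erase i, ‖f j‖ * ‖g j‖ := by
    rw [← norm_mul, eq_neg_of_add_eq_zero_left h, norm_neg]
    exact (norm_sum_le _ _).trans_eq (by simp only [norm_mul])
  have hamgm : 2 * ∑ j ∈ s.erase i, ‖f j‖ * ‖g j‖ ≤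
      ∑ j ∈ s.erase i, (‖f j‖ ^ 2 + ‖g j‖ ^ 2) := by
    rw [Finset.mul_sum]
    gcongr with j
    rw [← mul_assoc]
    exact two_mul_le_add_sq _ _
  linear_combination 2 * hmul + hamgm

theorem sum_jwSign_mul_eq_zero {φ : State n} (hφ : φ ∈ pureGaussian n) (x y : Fin n → Fin 2) :
    ∑ j with x j ≠ y j, jwSign j x * φ (x + Pi.single j 1) *
      (jwSign j y * φ (y + Pi.single j 1)) = 0 := by
  have hsign (s t : Fin 2) : (1 : ℂ) + -Complex.I * (-1) ^ (s : ℕ) * (-Complex.I * (-1) ^ (t : ℕ)) =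
      if s ≠ t then 2 else 0 := by
    fin_cases s <;> fin_cases t <;> norm_num
  have hentry : ∑ j, (jwSign j x * φ (x + Pi.single j 1) * (jwSign j y * φ (y + Pi.single j 1)) *
      if x j ≠ y j then 2 else 0) = 0 := by
    have hVVt := congrFun₂ (majoranaFrame_mul_transpose_of_mem_pureGaussian hφ) x y
    rw [Matrix.mul_apply, Fintype.sum_prod_type, Matrix.zero_apply] at hVVt
    refine Eq.trans (Finset.sum_congr rfl fun j _ => ?_) hVVt
    simp only [Fin.sum_univ_two, Matrix.transpose_apply, majoranaFrame, Matrix.of_apply,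
      majorana_zero_mulVec, majorana_one_mulVec, ← hsign]
    ring
  simp only [mul_ite, mul_zero, ← Finset.sum_filter, ← Finset.sum_mul] at hentry
  exact (mul_eq_zero.1 hentry).resolve_right two_ne_zero

theorem sum_norm_sq_add_single_le (φ : State n) {x y : Fin n → Fin 2}
    (hxy : 3 ≤ hammingDist x y) :
    ∑ j, (‖φ (x + Pi.single j 1)‖ ^ 2 + ‖φ (y + Pi.single j 1)‖ ^ 2) ≤ ‖φ‖ ^ 2 := by
  have hinj (z : Fin n → Fin 2) : Function.Injective fun j : Fin n => z + Pi.single j 1 := by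
    intro j k h
    by_contra hjk
    simpa [h] using hammingDist_add_single_add_single z hjk
  have hne (j k : Fin n) : x + Pi.single j 1 ≠ y + Pi.single k 1 := by
    intro h
    have htriangle := hammingDist_triangle x (x + Pi.single j 1) y
    rw [hammingDist_add_single, h, hammingDist_comm (y + _) y, hammingDist_add_single] at htriangle
    exact absurd (hxy.trans htriangle) (by norm_num)
  have helim : Function.Injective
      (Sum.elim (fun j : Fin n => x + Pi.single j 1) fun j : Fin n => y + Pi.single j 1) :=
    (hinj x).sumElim (hinj y) hne
  calc ∑ j, (‖φ (x + Pi.single j 1)‖ ^ 2 + ‖φ (y + Pi.single j 1)‖ ^ 2)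
    _ = ∑ j, ‖φ (Sum.elim (fun j : Fin n => x + Pi.single j 1)
          (fun j : Fin n => y + Pi.single j 1) j)‖ ^ 2 := by
      rw [Fintype.sum_sum_type, Finset.sum_add_distrib]
      rfl
    _ ≤ ∑ z, ‖φ z‖ ^ 2 :=
      (Finset.sum_map Finset.univ ⟨_, helim⟩ fun z => ‖φ z‖ ^ 2).symm.trans_le
        (Finset.sum_le_univ_sum_of_nonneg fun _ => sq_nonneg _)
    _ = ‖φ‖ ^ 2 := (EuclideanSpace.norm_sq_eq φ).symm

theorem norm_add_norm_le_one {φ : State n} (hφ : φ ∈ pureGaussian n) {r s : Fin n → Fin 2}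
    (hrs : 3 ≤ hammingDist r s) : ‖φ r‖ + ‖φ s‖ ≤ 1 := by
  obtain ⟨i, hi⟩ : ∃ i, r i ≠ s i := by
    by_contra! h
    simp [funext h] at hrs
  have hback (z : Fin n → Fin 2) : z + Pi.single i 1 + Pi.single i 1 = z := by
    rw [add_assoc, string_add_self, add_zero]
  set x := r + Pi.single i 1
  set y := s + Pi.single i 1
  have hxi : x i ≠ y i := by simpa [x, y] using hi
  have hbound := add_norm_sq_le_of_sum_mul_eq_zero (sum_jwSign_mul_eq_zero hφ x y)
    (Finset.mem_filter.2 ⟨Finset.mem_univ i, hxi⟩)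
  simp only [norm_mul, norm_jwSign, one_mul] at hbound
  rw [hback r, hback s] at hbound
  refine (sq_le_one_iff₀ (by positivity)).1 (hbound.trans ?_)
  calc _ ≤ ∑ j, (‖φ (x + Pi.single j 1)‖ ^ 2 + ‖φ (y + Pi.single j 1)‖ ^ 2) :=
        Finset.sum_le_univ_sum_of_nonneg fun _ => by positivity
    _ ≤ 1 := by
      simpa [hφ.1] using sum_norm_sq_add_single_le φ (by rwa [hammingDist_add_right])

/-! ### Superpositions of occupation basis vectors -/

/-- The expectation value `⟨ψ, Z_j ψ⟩`, as an explicit sum over the occupation basis. -/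
noncomputable def zExpect (ψ : State n) (j : Fin n) : ℝ := ∑ x, (-1) ^ (x j : ℕ) * ‖ψ x‖ ^ 2

/-- A state none of whose basis amplitudes couple under a product of two Majorana operators on
different modes: no two strings in its support are at Hamming distance two. -/
def PairSeparated (ψ : State n) : Prop :=
  ∀ x y, ψ x ≠ 0 → ψ y ≠ 0 → hammingDist x y ≠ 2

theorem conjTranspose_majoranaFrame_mul_same_mode (ψ : State n) (j : Fin n) :
    ((majoranaFrame ψ)ᴴ * majoranaFrame ψ) (j, 0) (j, 1) = Complex.I * zExpect ψ j := by
  rw [Matrix.mul_apply, zExpect, ← Equiv.sum_comp (Equiv.addRight (Pi.single j 1))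
    fun x => (-1 : ℝ) ^ (x j : ℕ) * ‖ψ x‖ ^ 2, Complex.ofReal_sum, Finset.mul_sum]
  refine Finset.sum_congr rfl fun x _ => ?_
  have hsign : (-1 : ℂ) ^ ((x j + 1 : Fin 2) : ℕ) = -(-1) ^ (x j : ℕ) := by
    generalize x j = t
    fin_cases t <;> simp
  have hnorm (z : ℂ) : star z * z = (‖z‖ : ℂ) ^ 2 := Complex.conj_mul' z
  simp only [Matrix.conjTranspose_apply, majoranaFrame, Matrix.of_apply, majorana_zero_mulVec,
    majorana_one_mulVec, Equiv.coe_addRight, Pi.add_apply, Pi.single_eq_same, star_mul']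
  push_cast
  rw [hsign]
  linear_combination -Complex.I * (-1) ^ (x j : ℕ) *
    (star (ψ (x + Pi.single j 1)) * ψ (x + Pi.single j 1) * star_jwSign_mul_self j x +
      hnorm (ψ (x + Pi.single j 1)))

theorem PairSeparated.conjTranspose_majoranaFrame_mul_eq_zero {ψ : State n}
    (hψ : PairSeparated ψ) {j k : Fin n} (hjk : j ≠ k) (c d : Fin 2) :
    ((majoranaFrame ψ)ᴴ * majoranaFrame ψ) (j, c) (k, d) = 0 := by
  rw [Matrix.mul_apply]
  refine Finset.sum_eq_zero fun x _ => ?_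
  simp only [Matrix.conjTranspose_apply, majoranaFrame, Matrix.of_apply, majorana_mulVec]
  by_cases hj : ψ (x + Pi.single j 1) = 0
  · simp [hj]
  by_cases hk : ψ (x + Pi.single k 1) = 0
  · simp [hk]
  exact absurd (hammingDist_add_single_add_single x hjk) (hψ _ _ hj hk)

theorem PairSeparated.covariance_eq {ψ : State n} (hψ : PairSeparated ψ) :
    covariance (density ψ) = Matrix.diagonal (zExpect ψ) ⊗ₖ !![0, 1; -1, 0] := by
  have hanti (a b) : covariance (density ψ) b a = -covariance (density ψ) a b :=
    congrFun₂ (covariance_transpose (density ψ)) a b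
  have hself (a) : covariance (density ψ) a a = 0 := self_eq_neg.1 (hanti a a)
  have hmode (j : Fin n) : covariance (density ψ) (j, 0) (j, 1) = zExpect ψ j := by
    simp [covariance_density_apply, conjTranspose_majoranaFrame_mul_same_mode]
  ext ⟨j, c⟩ ⟨k, d⟩
  rw [Matrix.kronecker_apply]
  rcases eq_or_ne j k with rfl | hjk
  · rw [Matrix.diagonal_apply_eq]
    fin_cases c <;> fin_cases d <;> simp [hself, hmode, hanti (j, 0) (j, 1)]
  · rw [Matrix.diagonal_apply_ne _ hjk, zero_mul, covariance_density_apply,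
      hψ.conjTranspose_majoranaFrame_mul_eq_zero hjk, Complex.zero_im]

theorem PairSeparated.covariance_sq {ψ : State n} (hψ : PairSeparated ψ) :
    covariance (density ψ) ^ 2 = -(Matrix.diagonal (zExpect ψ ^ 2) ⊗ₖ 1) := by
  have hJ : (!![0, 1; -1, 0] : Matrix (Fin 2) (Fin 2) ℝ) * !![0, 1; -1, 0] = (-1 : ℝ) • 1 := by
    simp [Matrix.one_fin_two]
  rw [hψ.covariance_eq, pow_two, ← Matrix.mul_kronecker_mul, hJ, ← pow_two, Matrix.diagonal_pow,
    Matrix.kronecker_smul, neg_one_smul]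

theorem PairSeparated.faf_one {ψ : State n} (hψ : PairSeparated ψ) :
    faf 1 (density ψ) = ∑ j, (1 - zExpect ψ j ^ 2) := by
  rw [faf, pow_one, hψ.covariance_sq, neg_neg, Matrix.trace_kronecker, Matrix.trace_diagonal,
    Matrix.trace_one, Fintype.card_fin, Finset.sum_sub_distrib, Finset.sum_const,
    Finset.card_univ, Fintype.card_fin, nsmul_one]
  simp only [Pi.pow_apply]
  push_cast
  ring

theorem ket_apply (r x : Fin n → Fin 2) : ket r x = if x = r then 1 else 0 := by
  simp [ket]

theorem norm_ket (r : Fin n → Fin 2) : ‖ket r‖ = 1 := by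
  rw [ket, PiLp.norm_single, norm_one]

theorem pairSeparated_ket (r : Fin n → Fin 2) : PairSeparated (ket r) := by
  intro x y hx hy
  simp only [ket_apply, ne_eq, ite_eq_right_iff, one_ne_zero, imp_false, not_not] at hx hy
  rw [hx, hy, hammingDist_self]
  norm_num

theorem zExpect_ket (r : Fin n → Fin 2) (j : Fin n) : zExpect (ket r) j = (-1) ^ (r j : ℕ) := by
  simp [zExpect, ket_apply, apply_ite]

theorem ket_mem_pureGaussian (r : Fin n → Fin 2) : ket r ∈ pureGaussian n := by
  refine ⟨norm_ket r, ?_⟩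
  have hsq : zExpect (ket r) ^ 2 = fun _ => 1 := by
    funext j
    rw [Pi.pow_apply, zExpect_ket, ← pow_mul, pow_mul', neg_one_sq, one_pow]
  rw [(pairSeparated_ket r).covariance_sq, hsq, Matrix.diagonal_one, Matrix.one_kronecker_one]

/-- The superposition `a |r⟩ + b |s⟩` of two occupation basis vectors. -/
noncomputable def twoKet (a b : ℂ) (r s : Fin n → Fin 2) : State n := a • ket r + b • ket s

theorem pairSeparated_twoKet (a b : ℂ) {r s : Fin n → Fin 2} (hrs : hammingDist r s ≠ 2) :
    PairSeparated (twoKet a b r s) := by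
  have hsupp {x} (hx : twoKet a b r s x ≠ 0) : x = r ∨ x = s := by
    contrapose! hx
    simp [twoKet, ket_apply, hx]
  intro x y hx hy
  rcases hsupp hx with rfl | rfl <;> rcases hsupp hy with rfl | rfl
  · simp
  · exact hrs
  · rwa [hammingDist_comm]
  · simp

theorem sum_mul_norm_sq_twoKet (a b : ℂ) {r s : Fin n → Fin 2} (hrs : r ≠ s)
    (F : (Fin n → Fin 2) → ℝ) :
    ∑ x, F x * ‖twoKet a b r s x‖ ^ 2 = F r * ‖a‖ ^ 2 + F s * ‖b‖ ^ 2 := by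
  have happly (x) : F x * ‖twoKet a b r s x‖ ^ 2 =
      (if x = r then F r * ‖a‖ ^ 2 else 0) + if x = s then F s * ‖b‖ ^ 2 else 0 := by
    rcases eq_or_ne x r with rfl | hr
    · simp [twoKet, ket_apply, hrs]
    · rcases eq_or_ne x s with rfl | hs <;> simp [twoKet, ket_apply, *]
  simp [happly, Finset.sum_add_distrib]

theorem norm_twoKet {a b : ℂ} (hab : ‖a‖ ^ 2 + ‖b‖ ^ 2 = 1) {r s : Fin n → Fin 2} (hrs : r ≠ s) :
    ‖twoKet a b r s‖ = 1 := by
  have hsum := sum_mul_norm_sq_twoKet a b hrs 1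
  simp only [Pi.one_apply, one_mul, ← EuclideanSpace.norm_sq_eq, hab] at hsum
  exact (pow_eq_one_iff_of_nonneg (norm_nonneg _) two_ne_zero).1 hsum

theorem faf_one_twoKet {a b : ℂ} (hab : ‖a‖ ^ 2 + ‖b‖ ^ 2 = 1) {r s : Fin n → Fin 2}
    (hrs : r ≠ s) (hrs₂ : hammingDist r s ≠ 2) :
    faf 1 (density (twoKet a b r s)) = hammingDist r s * (4 * ‖a‖ ^ 2 * ‖b‖ ^ 2) := by
  have hsign (p q : ℝ) (t u : Fin 2) : ((-1) ^ (t : ℕ) * p + (-1) ^ (u : ℕ) * q) ^ 2 =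
      (p + q) ^ 2 - if t ≠ u then 4 * p * q else 0 := by
    fin_cases t <;> fin_cases u <;> norm_num <;> ring
  have hterm (j) : 1 - zExpect (twoKet a b r s) j ^ 2 =
      if r j ≠ s j then 4 * ‖a‖ ^ 2 * ‖b‖ ^ 2 else 0 := by
    rw [zExpect, sum_mul_norm_sq_twoKet a b hrs fun x => (-1) ^ (x j : ℕ), hsign, hab, one_pow,
      sub_sub_cancel]
  rw [(pairSeparated_twoKet a b hrs₂).faf_one]
  simp only [hterm, ← Finset.sum_filter, Finset.sum_const, nsmul_eq_mul, hammingDist]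

theorem inner_twoKet (a b : ℂ) (r s : Fin n → Fin 2) (φ : State n) :
    inner ℂ (twoKet a b r s) φ = star a * φ r + star b * φ s := by
  simp [twoKet, ket, EuclideanSpace.inner_single_left, mul_comm]

theorem isLeast_gaussianDistances_twoKet {a b : ℂ} (hab : ‖a‖ ^ 2 + ‖b‖ ^ 2 = 1)
    (hba : ‖b‖ ≤ ‖a‖) {r s : Fin n → Fin 2} (hrs : 3 ≤ hammingDist r s) :
    IsLeast (gaussianDistances (twoKet a b r s)) ‖b‖ := by
  have hne : r ≠ s := by
    rintro rfl
    simp at hrs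
  have hnorm := norm_twoKet hab hne
  have hb : √(1 - ‖a‖ ^ 2) = ‖b‖ := by
    rw [← hab, add_sub_cancel_left, Real.sqrt_sq (norm_nonneg b)]
  constructor
  · refine ⟨ket r, ket_mem_pureGaussian r, ?_⟩
    simp only [traceDist_density hnorm (norm_ket r), inner_twoKet, ket_apply, if_neg hne.symm]
    simpa using hb
  · rintro _ ⟨φ, hφ, rfl⟩
    have hinner : ‖inner ℂ (twoKet a b r s) φ‖ ≤ ‖a‖ := by
      calc ‖inner ℂ (twoKet a b r s) φ‖
        _ ≤ ‖a‖ * ‖φ r‖ + ‖b‖ * ‖φ s‖ := by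
          rw [inner_twoKet]
          exact (norm_add_le _ _).trans_eq (by simp only [norm_mul, norm_star])
        _ ≤ ‖a‖ * (‖φ r‖ + ‖φ s‖) := by
          rw [mul_add]
          gcongr
        _ ≤ ‖a‖ := mul_le_of_le_one_right (norm_nonneg a) (norm_add_norm_le_one hφ hrs)
    change ‖b‖ ≤ traceDist (density (twoKet a b r s)) (density φ)
    rw [traceDist_density hnorm hφ.1, ← hb]
    gcongr


/-! ### The cat state and the localized defect -/

theorem isLeast_epsG {ψ : State n} {d : ℝ} (hd : IsLeast (gaussianDistances ψ) d) :
    IsLeast (gaussianDistances ψ) (epsG ψ) := by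
  rwa [epsG, hd.csInf_eq]

theorem hammingDist_zero_one (n : ℕ) :
    hammingDist (fun _ : Fin n => (0 : Fin 2)) (fun _ => 1) = n := by
  simp [hammingDist]

theorem norm_sq_sqrt_one_sub_sq_add {ε : ℝ} (hε : ε ^ 2 ≤ 1) :
    ‖((√(1 - ε ^ 2) : ℝ) : ℂ)‖ ^ 2 + ‖(ε : ℂ)‖ ^ 2 = 1 := by
  rw [Complex.norm_real, Complex.norm_real, Real.norm_eq_abs, Real.norm_eq_abs, sq_abs, sq_abs,
    Real.sq_sqrt (sub_nonneg.2 hε), sub_add_cancel]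

theorem norm_catState (hn : n ≠ 0) {ε : ℝ} (hε : ε ^ 2 ≤ 1) : ‖catState n ε‖ = 1 :=
  norm_twoKet (norm_sq_sqrt_one_sub_sq_add hε)
    (hammingDist_ne_zero.1 ((hammingDist_zero_one n).trans_ne hn))

theorem faf_one_catState (hn₀ : n ≠ 0) (hn₂ : n ≠ 2) {ε : ℝ} (hε : ε ^ 2 ≤ 1) :
    faf 1 (density (catState n ε)) = 4 * n * ε ^ 2 * (1 - ε ^ 2) := by
  have hdist := hammingDist_zero_one n
  have hab := norm_sq_sqrt_one_sub_sq_add hε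
  have hfaf := faf_one_twoKet hab (hammingDist_ne_zero.1 (hdist.trans_ne hn₀)) (hdist.trans_ne hn₂)
  rw [eq_sub_of_add_eq hab, hdist, Complex.norm_real, Real.norm_eq_abs, sq_abs] at hfaf
  exact hfaf.trans (by ring)

theorem isLeast_gaussianDistances_catState (hn : 3 ≤ n) {ε : ℝ} (hε₀ : 0 ≤ ε)
    (hε : ε ^ 2 ≤ 1 / 2) : IsLeast (gaussianDistances (catState n ε)) ε := by
  have hba : ‖(ε : ℂ)‖ ≤ ‖((√(1 - ε ^ 2) : ℝ) : ℂ)‖ := by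
    rw [Complex.norm_of_nonneg hε₀, Complex.norm_of_nonneg (Real.sqrt_nonneg _)]
    exact Real.le_sqrt_of_sq_le (by linarith)
  have hleast := isLeast_gaussianDistances_twoKet
    (norm_sq_sqrt_one_sub_sq_add (by linarith)) hba (hn.trans_eq (hammingDist_zero_one n).symm)
  rwa [Complex.norm_of_nonneg hε₀] at hleast

theorem epsG_catState (hn : 3 ≤ n) {ε : ℝ} (hε₀ : 0 ≤ ε) (hε : ε ^ 2 ≤ 1 / 2) :
    epsG (catState n ε) = ε :=
  (isLeast_gaussianDistances_catState hn hε₀ hε).csInf_eq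

theorem tensorState_ket {m k : ℕ} (u : Fin m → Fin 2) (v : Fin k → Fin 2) :
    tensorState (ket u) (ket v) = ket (Fin.append u v) := by
  ext x
  have happend : x = Fin.append u v ↔
      (fun i => x (Fin.castAdd k i)) = u ∧ (fun j => x (Fin.natAdd m j)) = v := by
    rw [← Prod.mk.injEq]
    exact ((Fin.appendEquiv m k).symm_apply_eq (x := x) (y := (u, v))).symm
  simp only [tensorState, ket_apply, happend, ite_and, ite_mul, one_mul, zero_mul]

theorem hammingDist_append {m k : ℕ} (u u' : Fin m → Fin 2) (v v' : Fin k → Fin 2) :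
    hammingDist (Fin.append u v) (Fin.append u' v') = hammingDist u u' + hammingDist v v' := by
  simp only [hammingDist, Finset.card_filter, Fin.sum_univ_add, Fin.append_left, Fin.append_right]

theorem defectState_eq_twoKet (m : ℕ) :
    defectState m = twoKet (1 / √2 : ℝ) (1 / √2 : ℝ) (Fin.append (fun _ => 0) fun _ => 0)
      (Fin.append (fun _ => 1) fun _ => 0) := by
  rw [twoKet, ← tensorState_ket, ← tensorState_ket, ← smul_add]
  ext x
  simp [defectState, tensorState, mul_assoc, add_mul]

theorem hammingDist_defect (m : ℕ) :
    hammingDist (Fin.append (fun _ : Fin 4 => (0 : Fin 2)) fun _ : Fin m => 0)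
      (Fin.append (fun _ => 1) fun _ => 0) = 4 := by
  rw [hammingDist_append, hammingDist_zero_one, hammingDist_self]

theorem norm_sq_one_div_sqrt_two : ‖((1 / √2 : ℝ) : ℂ)‖ ^ 2 = 1 / 2 := by
  rw [Complex.norm_real, Real.norm_eq_abs, sq_abs, div_pow, one_pow, Real.sq_sqrt zero_le_two]

theorem norm_sq_one_div_sqrt_two_add_self :
    ‖((1 / √2 : ℝ) : ℂ)‖ ^ 2 + ‖((1 / √2 : ℝ) : ℂ)‖ ^ 2 = 1 := by
  rw [norm_sq_one_div_sqrt_two, add_halves]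

theorem norm_defectState (m : ℕ) : ‖defectState m‖ = 1 := by
  rw [defectState_eq_twoKet]
  exact norm_twoKet norm_sq_one_div_sqrt_two_add_self
    (hammingDist_ne_zero.1 ((hammingDist_defect m).trans_ne four_ne_zero))

theorem faf_one_defectState (m : ℕ) : faf 1 (density (defectState m)) = 4 := by
  have hdist := hammingDist_defect m
  rw [defectState_eq_twoKet, faf_one_twoKet norm_sq_one_div_sqrt_two_add_self
    (hammingDist_ne_zero.1 (hdist.trans_ne four_ne_zero)) (hdist.trans_ne (by norm_num)), hdist,
    norm_sq_one_div_sqrt_two]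
  norm_num

theorem isLeast_gaussianDistances_defectState (m : ℕ) :
    IsLeast (gaussianDistances (defectState m)) ‖((1 / √2 : ℝ) : ℂ)‖ := by
  rw [defectState_eq_twoKet]
  exact isLeast_gaussianDistances_twoKet norm_sq_one_div_sqrt_two_add_self le_rfl
    (by norm_num [hammingDist_defect])

theorem epsG_defectState_sq (m : ℕ) : epsG (defectState m) ^ 2 = 1 / 2 := by
  rw [epsG, (isLeast_gaussianDistances_defectState m).csInf_eq, norm_sq_one_div_sqrt_two]

/-! ### Tightness -/

theorem eventually_pos_and_sq_le_half : ∀ᶠ ε : ℝ in 𝓝[>] 0, 0 < ε ∧ ε ^ 2 ≤ 1 / 2 := by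
  filter_upwards [Ioo_mem_nhdsGT (show (0 : ℝ) < 1 / 2 by norm_num)] with ε hε
  exact ⟨hε.1, by nlinarith [hε.1, hε.2]⟩

theorem tendsto_faf_one_div_epsG_sq_catState (hn : 3 ≤ n) :
    Filter.Tendsto (fun ε : ℝ => faf 1 (density (catState n ε)) / (n * epsG (catState n ε) ^ 2))
      (𝓝[>] 0) (𝓝 4) := by
  have hlim : Filter.Tendsto (fun ε : ℝ => 4 * (1 - ε ^ 2)) (𝓝 0) (𝓝 4) :=
    Continuous.tendsto' (by fun_prop) 0 4 (by norm_num)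
  refine (hlim.mono_left nhdsWithin_le_nhds).congr' ?_
  filter_upwards [eventually_pos_and_sq_le_half] with ε ⟨hε₀, hε⟩
  have hn₀ : (n : ℝ) ≠ 0 := by positivity
  rw [epsG_catState hn hε₀.le hε, faf_one_catState (by omega) (by omega) (by linarith)]
  field

theorem le_one_div_four_of_faf_one_le_epsG_sq (hn : 3 ≤ n) {c : ℝ}
    (hc : ∀ ψ : State n, ‖ψ‖ = 1 → c / n * faf 1 (density ψ) ≤ epsG ψ ^ 2) : c ≤ 1 / 4 := by
  have hlim := (tendsto_faf_one_div_epsG_sq_catState hn).const_mul c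
  have hle : c * 4 ≤ 1 := by
    refine le_of_tendsto hlim ?_
    filter_upwards [eventually_pos_and_sq_le_half] with ε ⟨hε₀, hε⟩
    have hcat := hc _ (norm_catState (by omega) (by linarith : ε ^ 2 ≤ 1))
    have hpos : 0 < epsG (catState n ε) ^ 2 := by
      rw [epsG_catState hn hε₀.le hε]
      positivity
    calc c * (faf 1 (density (catState n ε)) / (n * epsG (catState n ε) ^ 2))
      _ = c / n * faf 1 (density (catState n ε)) / epsG (catState n ε) ^ 2 := by ring
      _ ≤ 1 := (div_le_one hpos).2 hcat
  linarith

theorem not_exists_pos_mul_faf_one_le_epsG_sq :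
    ¬ ∃ c : ℝ, 0 < c ∧ ∀ n : ℕ, 0 < n → ∀ ψ : State n, ‖ψ‖ = 1 →
      c * faf 1 (density ψ) ≤ epsG ψ ^ 2 := by
  rintro ⟨c, hc₀, hc⟩
  obtain ⟨n, hn⟩ := exists_nat_gt (max 3 (1 / c))
  obtain ⟨hn₃, hn₁⟩ := max_lt_iff.1 hn
  have hn₀ : (0 : ℝ) < n := by linarith
  have hcn : c * n ≤ 1 / 4 :=
    le_one_div_four_of_faf_one_le_epsG_sq (by exact_mod_cast hn₃.le) fun ψ hψ => by
      rw [mul_div_cancel_right₀ c hn₀.ne']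
      exact hc n (by exact_mod_cast hn₀) ψ hψ
  rw [div_lt_iff₀' hc₀] at hn₁
  linarith

theorem not_exists_epsG_sq_le_mul_faf_one_div :
    ¬ ∃ C : ℝ, ∀ n : ℕ, 0 < n → ∀ ψ : State n, ‖ψ‖ = 1 →
      epsG ψ ^ 2 ≤ C * faf 1 (density ψ) / n := by
  rintro ⟨C, hC⟩
  obtain ⟨m, hm⟩ := exists_nat_gt (8 * C)
  have hle := hC (4 + m) (by omega) _ (norm_defectState m)
  rw [epsG_defectState_sq, faf_one_defectState, le_div_iff₀ (by positivity)] at hle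
  push_cast at hle
  linarith

end FAF

theorem mainTheorem10_general :
    (∀ n : ℕ, 3 ≤ n → ∀ ε : ℝ, 0 ≤ ε → ε ^ 2 ≤ 1 / 2 →
      ‖FAF.catState n ε‖ = 1 ∧
      IsLeast (FAF.gaussianDistances (FAF.catState n ε)) (FAF.epsG (FAF.catState n ε)) ∧
      FAF.epsG (FAF.catState n ε) = ε ∧
      FAF.faf 1 (FAF.density (FAF.catState n ε)) = 4 * n * ε ^ 2 * (1 - ε ^ 2)) ∧
    (∀ n : ℕ, 3 ≤ n →
      Filter.Tendsto
        (fun ε : ℝ => FAF.faf 1 (FAF.density (FAF.catState n ε)) /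
          (n * FAF.epsG (FAF.catState n ε) ^ 2)) (𝓝[>] 0) (𝓝 4)) ∧
    (∀ n : ℕ, 3 ≤ n → ∀ c : ℝ,
      (∀ ψ : FAF.State n, ‖ψ‖ = 1 →
        c / n * FAF.faf 1 (FAF.density ψ) ≤ FAF.epsG ψ ^ 2) → c ≤ 1 / 4) ∧
    (¬ ∃ c : ℝ, 0 < c ∧ ∀ n : ℕ, 0 < n → ∀ ψ : FAF.State n, ‖ψ‖ = 1 →
      c * FAF.faf 1 (FAF.density ψ) ≤ FAF.epsG ψ ^ 2) ∧
    (∀ m : ℕ,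
      ‖FAF.defectState m‖ = 1 ∧
      IsLeast (FAF.gaussianDistances (FAF.defectState m)) (FAF.epsG (FAF.defectState m)) ∧
      FAF.faf 1 (FAF.density (FAF.defectState m)) = 4 ∧
      FAF.epsG (FAF.defectState m) ^ 2 = 1 / 2) ∧
    (¬ ∃ C : ℝ, ∀ n : ℕ, 0 < n → ∀ ψ : FAF.State n, ‖ψ‖ = 1 →
      FAF.epsG ψ ^ 2 ≤ C * FAF.faf 1 (FAF.density ψ) / n) := by
  refine ⟨fun n hn ε hε₀ hε => ?_, fun n => FAF.tendsto_faf_one_div_epsG_sq_catState,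
    fun n hn c => FAF.le_one_div_four_of_faf_one_le_epsG_sq hn,
    FAF.not_exists_pos_mul_faf_one_le_epsG_sq, fun m => ?_,
    FAF.not_exists_epsG_sq_le_mul_faf_one_div⟩
  · have hε₁ : ε ^ 2 ≤ 1 := by linarith
    have hleast := FAF.isLeast_gaussianDistances_catState hn hε₀ hε
    exact ⟨FAF.norm_catState (by omega) hε₁, FAF.isLeast_epsG hleast, FAF.epsG_catState hn hε₀ hε,
      FAF.faf_one_catState (by omega) (by omega) hε₁⟩
  · exact ⟨FAF.norm_defectState m, FAF.isLeast_epsG (FAF.isLeast_gaussianDistances_defectState m),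
      FAF.faf_one_defectState m, FAF.epsG_defectState_sq m⟩

theorem mainTheorem10 :
    -- the delocalized cat state
    (∀ n : ℕ, Even n → 4 ≤ n → ∀ ε : ℝ, 0 ≤ ε → ε ^ 2 ≤ 1 / 2 →
      ‖FAF.catState n ε‖ = 1 ∧
      IsLeast (FAF.gaussianDistances (FAF.catState n ε)) (FAF.epsG (FAF.catState n ε)) ∧
      FAF.epsG (FAF.catState n ε) = ε ∧
      FAF.faf 1 (FAF.density (FAF.catState n ε)) = 4 * n * ε ^ 2 * (1 - ε ^ 2)) ∧
    -- essential tightness of the factor `1 / (4 n)`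
    (∀ n : ℕ, Even n → 4 ≤ n →
      Filter.Tendsto
        (fun ε : ℝ => FAF.faf 1 (FAF.density (FAF.catState n ε)) /
          (n * FAF.epsG (FAF.catState n ε) ^ 2)) (𝓝[>] 0) (𝓝 4)) ∧
    (∀ n : ℕ, Even n → 4 ≤ n → ∀ c : ℝ,
      (∀ ψ : FAF.State n, ‖ψ‖ = 1 →
        c / n * FAF.faf 1 (FAF.density ψ) ≤ FAF.epsG ψ ^ 2) → c ≤ 1 / 4) ∧
    (¬ ∃ c : ℝ, 0 < c ∧ ∀ n : ℕ, 0 < n → ∀ ψ : FAF.State n, ‖ψ‖ = 1 →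
      c * FAF.faf 1 (FAF.density ψ) ≤ FAF.epsG ψ ^ 2) ∧
    -- the localized defect on `n = 4 + m` modes
    (∀ m : ℕ,
      ‖FAF.defectState m‖ = 1 ∧
      IsLeast (FAF.gaussianDistances (FAF.defectState m)) (FAF.epsG (FAF.defectState m)) ∧
      FAF.faf 1 (FAF.density (FAF.defectState m)) = 4 ∧
      FAF.epsG (FAF.defectState m) ^ 2 = 1 / 2) ∧
    (¬ ∃ C : ℝ, ∀ n : ℕ, 0 < n → ∀ ψ : FAF.State n, ‖ψ‖ = 1 →
      FAF.epsG ψ ^ 2 ≤ C * FAF.faf 1 (FAF.density ψ) / n) := by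
  obtain ⟨hcat, htendsto, hle, hrest⟩ := mainTheorem10_general
  exact ⟨fun n _ hn => hcat n (by omega), fun n _ hn => htendsto n (by omega),
    fun n _ hn => hle n (by omega), hrest⟩
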